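/- Let $p>3$ be a prime and $q=p^h$ with $h\in\mathbb{N}$, $h \ge 1$. Then there is a sequence $\omega=(\omega_i)_{i\ge 0}$ of pairwise distinct non-zero polynomials in $\mathbb{F}_q[t]$ such that (i) $\omega$ is a $B_2[2]$ sequence: every $n\in\mathbb{F}_q[t]$ (including $n=0$) has at most two representations $n=a+a'$ with $a,a'$ terms of $\omega$, where $a=a'$ is allowed and representations differing only in the order of the two summands are counted as one; and (ii) $\omega$ is an asymptotic basis of order $3$: there is an integer $D$ such that every $n\in\mathbb{F}_q[t]$ with $\deg n\ge D$ can be written as $n=a_1+a_2+a_3$ with $a_1,a_2,a_3$ (not necessarily distinct) terms of $\omega$. -/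

import Mathlib

open Polynomial

/-- The representations `n = a + a'` with `a, a' ∈ A`, the order of the two summands being
disregarded (and `a = a'` allowed): the set of unordered pairs `{a, a'}` with sum `n`. -/
def sumRepr {G : Type*} [AddCommGroup G] (A : Set G) (n : G) : Set (Sym2 G) :=
  {s | ∃ a ∈ A, ∃ a' ∈ A, a + a' = n ∧ s = s(a, a')}

/-- `A` is `B_2[g]`: every element has at most `g` representations as a sum of two
elements of `A`. -/
def IsB2 {G : Type*} [AddCommGroup G] (g : ℕ) (A : Set G) : Prop :=
  ∀ n : G, (sumRepr A n).encard ≤ g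

/-- `A` is an asymptotic basis of order `g`: every polynomial of sufficiently large degree
is a sum of `g` (not necessarily distinct) elements of `A`. -/
def IsAsymptoticBasis {F : Type*} [Field F] (g : ℕ) (A : Set F[X]) : Prop :=
  ∃ D : ℕ, ∀ n : F[X], D ≤ n.natDegree →
    n ≠ 0 → ∃ a : Fin g → F[X], (∀ i, a i ∈ A) ∧ ∑ i, a i = n

open scoped Pointwise

/-! More is true: some Sidon set `A` of nonzero polynomials satisfies `A + A = F[X]`. Adding one
fixed element of `A` to the sums turns order two into order three. Such an `A` is built greedily
along an enumeration of `F[X]`. To represent `n`, a finite Sidon set receives `x` and `n - x`;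
unwanted coincidences have the form `k • x = t` with `1 ≤ k ≤ 4` and `t` in a fixed finite set, so a
generic `x` avoids them all (`IsSidonSet.exists_finite_extension`). -/

/-- `S` is a Sidon set: a sum of two elements of `S` determines its summands up to order. -/
def IsSidonSet {G : Type*} [AddCommGroup G] (S : Set G) : Prop :=
  ∀ ⦃a⦄, a ∈ S → ∀ ⦃b⦄, b ∈ S → ∀ ⦃c⦄, c ∈ S → ∀ ⦃d⦄, d ∈ S →
    a + b = c + d → (a = c ∧ b = d) ∨ (a = d ∧ b = c)

section Sidon

variable {G : Type*} [AddCommGroup G]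

theorem IsSidonSet.isB2_one {S : Set G} (hS : IsSidonSet S) : IsB2 1 S := by
  intro n
  rw [Nat.cast_one, Set.encard_le_one_iff]
  rintro _ _ ⟨a, ha, b, hb, hab, rfl⟩ ⟨c, hc, d, hd, hcd, rfl⟩
  rw [Sym2.eq_iff]
  exact hS ha hb hc hd (hab.trans hcd.symm)

theorem IsB2.mono {g g' : ℕ} (hg : g ≤ g') {A : Set G} (hA : IsB2 g A) : IsB2 g' A :=
  fun n => (hA n).trans (by exact_mod_cast hg)

/-- Once copies of `y` on opposite sides cancel, it survives on one side only: once (`h1`) or twice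
(`h2`). -/
theorem IsSidonSet.insert_of_ne {S : Set G} (hS : IsSidonSet S) {y : G}
    (h1 : ∀ a ∈ S, ∀ b ∈ S, ∀ c ∈ S, y ≠ a + b - c) (h2 : ∀ a ∈ S, ∀ b ∈ S, y + y ≠ a + b) :
    IsSidonSet (insert y S) := by
  have hy : y ∉ S := fun h => h1 y h y h y h (by abel)
  have h3 : ∀ a ∈ S, ∀ b ∈ S, ∀ c ∈ S, y + c ≠ a + b := fun a ha b hb c hc h =>
    h1 a ha b hb c hc (eq_sub_of_add_eq h)
  have key : ∀ b ∈ insert y S, ∀ c ∈ insert y S, ∀ d ∈ insert y S, y + b = c + d →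
      (y = c ∧ b = d) ∨ (y = d ∧ b = c) := by
    rintro b hb c (rfl | hc) d hd h
    · exact .inl ⟨rfl, add_left_cancel h⟩
    rcases hd with rfl | hd
    · exact .inr ⟨rfl, add_left_cancel (h.trans (add_comm _ _))⟩
    rcases hb with rfl | hb
    · exact absurd h (h2 c hc d hd)
    · exact absurd h (h3 c hc d hd b hb)
  rintro a (rfl | ha) b hb c hc d hd h
  · exact key b hb c hc d hd h
  rcases hb with rfl | hb
  · have := key a (.inr ha) c hc d hd ((add_comm _ _).trans h)
    tauto
  rcases hc with rfl | hc
  · have := key d hd a (.inr ha) b (.inr hb) h.symm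
    grind
  rcases hd with rfl | hd
  · have := key c (.inr hc) a (.inr ha) b (.inr hb) ((add_comm _ _).trans h.symm)
    grind
  exact hS ha hb hc hd h

theorem IsSidonSet.iUnion_of_monotone {S : ℕ → Set G} (hS : ∀ k, IsSidonSet (S k))
    (hmono : Monotone S) : IsSidonSet (⋃ k, S k) := by
  intro a ha b hb c hc d hd h
  simp only [Set.mem_iUnion] at ha hb hc hd
  obtain ⟨i, ha⟩ := ha
  obtain ⟨j, hb⟩ := hb
  obtain ⟨k, hc⟩ := hc
  obtain ⟨l, hd⟩ := hd
  exact hS (max (max i j) (max k l)) (hmono (by simp) ha) (hmono (by simp) hb)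
    (hmono (by simp) hc) (hmono (by simp) hd) h

/-- In an infinite group whose multiplication maps by `1, …, m` are injective, some element has
its first `m` multiples outside a given finite set. -/
theorem exists_nsmul_notMem_finite [Infinite G] (m : ℕ)
    (hinj : ∀ k : ℕ, k ≠ 0 → k ≤ m → Function.Injective fun x : G => k • x)
    {T : Set G} (hT : T.Finite) : ∃ x : G, ∀ k : ℕ, k ≠ 0 → k ≤ m → k • x ∉ T := by
  have hfin : (⋃ k ∈ {k : ℕ | k ≠ 0 ∧ k ≤ m}, (fun x : G => k • x) ⁻¹' T).Finite :=
    ((Set.finite_Iic m).subset fun _ h => h.2).biUnion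
      fun k hk => hT.preimage (hinj k hk.1 hk.2).injOn
  obtain ⟨x, hx⟩ := hfin.exists_notMem
  refine ⟨x, fun k h0 hk hmem => hx ?_⟩
  simp only [Set.mem_iUnion]
  exact ⟨k, ⟨h0, hk⟩, hmem⟩

/-- A finite Sidon set avoiding `0` extends to one in which a prescribed `n` is a sum of two
elements. -/
theorem IsSidonSet.exists_finite_extension [Infinite G]
    (hinj : ∀ k : ℕ, k ≠ 0 → k ≤ 4 → Function.Injective fun x : G => k • x)
    {S : Set G} (hfin : S.Finite) (hS : IsSidonSet S) (h0 : (0 : G) ∉ S) (n : G) :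
    ∃ S' : Set G, S ⊆ S' ∧ S'.Finite ∧ IsSidonSet S' ∧ (0 : G) ∉ S' ∧
      ∃ a ∈ S', ∃ b ∈ S', a + b = n := by
  by_cases hn : ∃ a ∈ S, ∃ b ∈ S, a + b = n
  · exact ⟨S, subset_rfl, hfin, hS, h0, hn⟩
  push Not at hn
  -- Including `0` pads shorter relations to two added and two subtracted terms.
  set V : Set G := insert 0 (insert n S) with hV
  have hVfin : V.Finite := (hfin.insert n).insert 0
  have z : (0 : G) ∈ V := by simp [hV]
  have w : n ∈ V := by simp [hV]
  have s : ∀ {a}, a ∈ S → a ∈ V := fun h => by simp [hV, h]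
  obtain ⟨x, hx⟩ := exists_nsmul_notMem_finite 4 hinj
    ((hVfin.add hVfin).sub (hVfin.add hVfin))
  have avoid : ∀ k : ℕ, k ≠ 0 → k ≤ 4 → ∀ {a b c d : G}, a ∈ V → b ∈ V → c ∈ V → d ∈ V →
      k • x = a + b - (c + d) → False := fun k hk hk' a b c d ha hb hc hd h =>
    hx k hk hk' (h ▸ Set.sub_mem_sub (Set.add_mem_add ha hb) (Set.add_mem_add hc hd))
  have hxS : IsSidonSet (insert x S) := by
    refine hS.insert_of_ne (fun a ha b hb c hc h => ?_) fun a ha b hb h => ?_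
    · exact avoid 1 (by simp) (by simp) (s ha) (s hb) (s hc) z (by rw [one_smul, h]; abel)
    · exact avoid 2 (by simp) (by simp) (s ha) (s hb) z z (by rw [two_smul, h]; abel)
  refine ⟨insert (n - x) (insert x S),
    (Set.subset_insert _ _).trans (Set.subset_insert _ _), (hfin.insert x).insert _,
    hxS.insert_of_ne ?_ ?_, ?_, n - x, by simp, x, by simp, by abel⟩
  · rintro a (rfl | ha) b (rfl | hb) c (rfl | hc) h
    · exact avoid 2 (by simp) (by simp) w z z z
        (by linear_combination (norm := module) (-1 : ℤ) • h)
    · exact avoid 3 (by simp) (by simp) w (s hc) z z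
        (by linear_combination (norm := module) (-1 : ℤ) • h)
    · exact avoid 1 (by simp) (by simp) w z (s hb) z
        (by linear_combination (norm := module) (-1 : ℤ) • h)
    · exact avoid 2 (by simp) (by simp) w (s hc) (s hb) z
        (by linear_combination (norm := module) (-1 : ℤ) • h)
    · exact avoid 1 (by simp) (by simp) w z (s ha) z
        (by linear_combination (norm := module) (-1 : ℤ) • h)
    · exact avoid 2 (by simp) (by simp) w (s hc) (s ha) z
        (by linear_combination (norm := module) (-1 : ℤ) • h)
    -- Only here does `x` cancel, leaving `n = a + b`, excluded since `n` is not yet represented.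
    · exact hn a ha b hb (sub_left_injective h).symm
    · exact avoid 1 (by simp) (by simp) w (s hc) (s ha) (s hb)

        (by linear_combination (norm := module) (-1 : ℤ) • h)
  · rintro a (rfl | ha) b (rfl | hb) h
    -- The bound 4 comes from `(n - x) + (n - x) = x + x`.
    · exact avoid 4 (by simp) (by simp) w w z z
        (by linear_combination (norm := module) (-1 : ℤ) • h)
    · exact avoid 3 (by simp) (by simp) w w (s hb) z
        (by linear_combination (norm := module) (-1 : ℤ) • h)
    · exact avoid 3 (by simp) (by simp) w w (s ha) z
        (by linear_combination (norm := module) (-1 : ℤ) • h)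
    · exact avoid 2 (by simp) (by simp) w w (s ha) (s hb)
        (by linear_combination (norm := module) (-1 : ℤ) • h)
  · rintro (h | h | h)
    · exact avoid 1 (by simp) (by simp) w z z z
        (by linear_combination (norm := module) (1 : ℤ) • h)
    · exact avoid 1 (by simp) (by simp) z z z z
        (by linear_combination (norm := module) (-1 : ℤ) • h)
    · exact h0 h

/-- A countable infinite group on which multiplication by `1, 2, 3, 4` is injective has a Sidon set
of nonzero elements that is a basis of order two. -/
theorem exists_isSidonSet_basis_two [Infinite G] [Countable G]
    (hinj : ∀ k : ℕ, k ≠ 0 → k ≤ 4 → Function.Injective fun x : G => k • x) :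
    ∃ A : Set G, IsSidonSet A ∧ (0 : G) ∉ A ∧ ∀ n, ∃ a ∈ A, ∃ b ∈ A, a + b = n := by
  obtain ⟨f, hf⟩ := exists_surjective_nat G
  let P := {S : Set G // S.Finite ∧ IsSidonSet S ∧ (0 : G) ∉ S}
  have step : ∀ (S : P) (n : G), ∃ S' : P, S.1 ⊆ S'.1 ∧ ∃ a ∈ S'.1, ∃ b ∈ S'.1, a + b = n := by
    rintro ⟨S, hfin, hS, h0⟩ n
    obtain ⟨S', hsub, hfin', hS', h0', hn⟩ := hS.exists_finite_extension hinj hfin h0 n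
    exact ⟨⟨S', hfin', hS', h0'⟩, hsub, hn⟩
  choose next hsub hnext using step
  let seq : ℕ → P := fun k => Nat.rec ⟨∅, by simp [IsSidonSet]⟩ (fun k S => next S (f k)) k
  refine ⟨⋃ k, (seq k).1, IsSidonSet.iUnion_of_monotone (fun k => (seq k).2.2.1)
    (monotone_nat_of_le_succ fun k => hsub (seq k) (f k)), ?_, fun n => ?_⟩
  · simpa using fun k => (seq k).2.2.2
  · obtain ⟨k, rfl⟩ := hf n
    obtain ⟨a, ha, b, hb, hab⟩ := hnext (seq k) (f k)
    exact ⟨a, Set.mem_iUnion.2 ⟨k + 1, ha⟩, b, Set.mem_iUnion.2 ⟨k + 1, hb⟩, hab⟩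

end Sidon

theorem isAsymptoticBasis_three_of_basis_two {F : Type*} [Field F] {A : Set F[X]}
    (hA : ∀ n, ∃ a ∈ A, ∃ b ∈ A, a + b = n) : IsAsymptoticBasis 3 A := by
  -- Any element of `A` can serve as the constant third summand.
  obtain ⟨c, hc, -⟩ := hA 0
  refine ⟨0, fun n _ _ => ?_⟩
  obtain ⟨a, ha, b, hb, hab⟩ := hA (n - c)
  refine ⟨![a, b, c], fun i => ?_, ?_⟩
  · fin_cases i <;> assumption
  · simp [Fin.sum_univ_three, hab]

theorem natCast_ne_zero_of_card_eq_prime_pow {p h : ℕ} (hp : p.Prime)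
    {F : Type*} [Field F] [Fintype F] (hF : Fintype.card F = p ^ h) {k : ℕ} (hk : ¬ p ∣ k) :
    (k : F) ≠ 0 := by
  have hp0 : (p : F) = 0 := by
    have := Nat.cast_card_eq_zero F
    rw [hF, Nat.cast_pow] at this
    exact eq_zero_of_pow_eq_zero this
  have := (CharP.charP_iff_prime_eq_zero hp).2 hp0
  rwa [Ne, CharP.cast_eq_zero_iff F p]

theorem nsmul_polynomial_injective {F : Type*} [Field F] {k : ℕ} (hk : (k : F) ≠ 0) :
    Function.Injective fun x : F[X] => k • x := by
  intro x y hxy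
  have hk' : (k : F[X]) ≠ 0 := by
    rw [← C_eq_natCast]
    exact C_ne_zero.2 hk
  simpa [nsmul_eq_mul, hk'] using hxy

theorem theorem1p3 (p h : ℕ) (hp : p.Prime) (hp3 : 3 < p)
    (F : Type*) [Field F] [Fintype F] (hF : Fintype.card F = p ^ h) :
    ∃ ω : ℕ → F[X], Function.Injective ω ∧ (∀ i, ω i ≠ 0) ∧
      IsB2 2 (Set.range ω) ∧ IsAsymptoticBasis 3 (Set.range ω) := by
  have hp4 : 4 < p := by
    refine lt_of_le_of_ne hp3 ?_
    rintro rfl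
    exact absurd hp (by norm_num)
  have : Countable F[X] := by
    rw [← Cardinal.mk_le_aleph0_iff]
    exact cardinalMk_le_max.trans (by simp)
  obtain ⟨A, hA, h0, hbasis⟩ := exists_isSidonSet_basis_two (G := F[X]) fun k hk hk4 =>
    nsmul_polynomial_injective <| natCast_ne_zero_of_card_eq_prime_pow hp hF <|
      Nat.not_dvd_of_pos_of_lt (Nat.pos_of_ne_zero hk) (hk4.trans_lt hp4)
  have hinf : Infinite A := by
    rw [Set.infinite_coe_iff]
    intro hfin
    -- A finite `A` would make `A + A`, the whole of `F[X]`, finite.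
    refine Set.infinite_univ ((hfin.add hfin).subset fun n _ => ?_)
    obtain ⟨a, ha, b, hb, hab⟩ := hbasis n
    exact ⟨a, ha, b, hb, hab⟩
  obtain ⟨e⟩ := nonempty_equiv_of_countable (α := ℕ) (β := A)
  have hrange : Set.range (fun i => (e i : F[X])) = A := by
    rw [← Function.comp_def, EquivLike.range_comp (Subtype.val) e, Subtype.range_coe]
  refine ⟨fun i => e i, Subtype.val_injective.comp e.injective, fun i hi => h0 (hi ▸ (e i).2), ?_⟩
  rw [hrange]
  exact ⟨hA.isB2_one.mono one_le_two, isAsymptoticBasis_three_of_basis_two hbasis⟩
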